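/- For $N\ge 1$ consider the homogeneous XX chain of $N$ spins, with Hamiltonian $H=\sum_{l=1}^{N-1}\left(\sigma^x_l\sigma^x_{l+1}+\sigma^y_l\sigma^y_{l+1}\right)$ on $(\mathbb{C}^2)^{\otimes N}$, where $\sigma^x_l,\sigma^y_l$ are the Pauli matrices acting on spin $l$. Let $|l\rangle$ be the basis state in which spin $l$ is down and all the others are up, let $H_1$ be the restriction of $H$ to the span of $|1\rangle,\dots,|N\rangle$, let $v_1,\dots,v_N$ be an orthonormal eigenbasis of $H_1$, and put $$p^{[1:N]}_{\max}(i,j)=\Big|\sum_{k=1}^N\big|\langle i|v_k\rangle\langle v_k|j\rangle\big|\Big|^2 .$$ (The spectrum of $H_1$ is simple, so this does not depend on the eigenbasis.) Let $i',j'$ be positive integers, let $\mathbf{i}'=i'/\gcd(i',j')$ and $\mathbf{j}'=j'/\gcd(i',j')$, and for chains of odd length $N=2n+1$, with positions measured from the central spin $n+1$, define $$\sqrt{p^{\leftrightarrow}_{\max}(i',j')}=\lim_{n\to\infty}\sqrt{p^{[1:2n+1]}_{\max}\big(n+1+i',\,n+1+j'\big)} .$$ This limit exists, and the following holds. (1)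 If $i'$ and $j'$ are both odd, or both even with the same power of $2$ in their prime factorizations, then $$\sqrt{p^{\leftrightarrow}_{\max}(i',j')}=\frac{4}{\pi^2}\left(2+\sum_{m=2,4,6,\dots}\frac{4}{(m^2\mathbf{i}'^2-1)(m^2\mathbf{j}'^2-1)}\right),$$ and, if moreover $i'\neq j'$, this equals $$\frac{8}{\pi^2}\cdot\frac{1}{\mathbf{i}'^2-\mathbf{j}'^2}\left(\mathbf{i}'^2\,\frac{\pi}{2\mathbf{i}'}\cot\frac{\pi}{2\mathbf{i}'}-\mathbf{j}'^2\,\frac{\pi}{2\mathbf{j}'}\cot\frac{\pi}{2\mathbf{j}'}\right).$$ (2) If $i'$ and $j'$ are both even with different powers of $2$ in their prime factorizations, or one of them is odd and the other even, then $$\sqrt{p^{\leftrightarrow}_{\max}(i',j')}=\frac{4}{\pi^2}\left(2+\sum_{m=4,8,12,\dots}\frac{4}{(m^2\mathbf{i}'^2-1)(m^2\mathbf{j}'^2-1)}\right) =\frac{8}{\pi^2}\left(\frac{\mathbf{i}'^2}{\mathbf{i}'^2-\mathbf{j}'^2}\,\frac{\pi}{4\mathbf{i}'}\cot\frac{\pi}{4\mathbf{i}'}-\frac{\mathbf{j}'^2}{\mathbf{i}'^2-\mathbf{j}'^2}\,\frac{\pi}{4\mathbf{j}'}\cot\frac{\pi}{4\mathbf{j}'}\right).$$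 -/

import Mathlib

open scoped Matrix

namespace XXChain

noncomputable section

/-- The Pauli matrix `σˣ`; index `0` is spin up, index `1` is spin down. -/
def pauliX : Matrix (Fin 2) (Fin 2) ℂ := !![0, 1; 1, 0]

/-- The Pauli matrix `σʸ`. -/
def pauliY : Matrix (Fin 2) (Fin 2) ℂ := !![0, -Complex.I; Complex.I, 0]

/-- The tensor product `A₁ ⊗ ⋯ ⊗ A_N` of `2 × 2` matrices, as a matrix on the
configurations `Fin N → Fin 2` of `N` spins (the standard basis of `(ℂ²)^{⊗N}`). -/
def tensorOp {N : ℕ} (A : Fin N → Matrix (Fin 2) (Fin 2) ℂ) :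
    Matrix (Fin N → Fin 2) (Fin N → Fin 2) ℂ :=
  Matrix.of fun s t => ∏ k, A k (s k) (t k)

/-- `I ⊗ ⋯ ⊗ I ⊗ σ ⊗ I ⊗ ⋯ ⊗ I` with the factor `σ` at the site `i`. -/
def siteOp {N : ℕ} (i : Fin N) (σ : Matrix (Fin 2) (Fin 2) ℂ) :
    Matrix (Fin N → Fin 2) (Fin N → Fin 2) ℂ :=
  tensorOp fun k => if k = i then σ else 1

/-- The Hamiltonian `∑_{i=1}^{N-1} (σˣ_i σˣ_{i+1} + σʸ_i σʸ_{i+1})` of the homogeneous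
XX chain of `N` spins; the sum is over the pairs of consecutive sites. -/
def hamiltonian (N : ℕ) : Matrix (Fin N → Fin 2) (Fin N → Fin 2) ℂ :=
  ∑ i : Fin N, ∑ j : Fin N, if (j : ℕ) = (i : ℕ) + 1 then
    siteOp i pauliX * siteOp j pauliX + siteOp i pauliY * siteOp j pauliY else 0

/-- The configuration of the state `|i⟩`: spin `i` is down, all the others are up. -/
def excitation {N : ℕ} (i : Fin N) : Fin N → Fin 2 := fun k => if k = i then 1 else 0

/-- The restriction `H₁` of the Hamiltonian to the single excitation subspace, as its
matrix in the basis `|1⟩, …, |N⟩`. -/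
def singleHamiltonian (N : ℕ) : Matrix (Fin N) (Fin N) ℂ :=
  (hamiltonian N).submatrix excitation excitation

theorem tensorOp_mul {N : ℕ} (A B : Fin N → Matrix (Fin 2) (Fin 2) ℂ) :
    tensorOp A * tensorOp B = tensorOp fun k => A k * B k := by
  ext s t
  simp only [tensorOp, Matrix.mul_apply, Matrix.of_apply, ← Finset.prod_mul_distrib]
  rw [Finset.prod_univ_sum, Fintype.piFinset_univ]

theorem tensorOp_isHermitian {N : ℕ} (A : Fin N → Matrix (Fin 2) (Fin 2) ℂ)
    (hA : ∀ k, (A k).IsHermitian) : (tensorOp A).IsHermitian := by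
  ext s t
  simp only [tensorOp, Matrix.conjTranspose_apply, Matrix.of_apply, star_prod]
  exact Finset.prod_congr rfl fun k _ => (hA k).apply _ _

theorem siteOp_mul_isHermitian {N : ℕ} {i j : Fin N} (hij : i ≠ j)
    (σ : Matrix (Fin 2) (Fin 2) ℂ) (hσ : σ.IsHermitian) :
    (siteOp i σ * siteOp j σ).IsHermitian := by
  rw [siteOp, siteOp, tensorOp_mul]
  refine tensorOp_isHermitian _ fun k => ?_
  by_cases h1 : k = i
  · have h2 : k ≠ j := fun h => hij (h1.symm.trans h)
    simpa [h1, hij] using hσ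
  · by_cases h2 : k = j
    · simpa [h2, hij.symm] using hσ
    · simp [h1, h2]

theorem singleHamiltonian_isHermitian (N : ℕ) : (singleHamiltonian N).IsHermitian := by
  refine Matrix.IsHermitian.submatrix ?_ _
  have hX : pauliX.IsHermitian := by
    ext a b
    fin_cases a <;> fin_cases b <;> simp [pauliX]
  have hY : pauliY.IsHermitian := by
    ext a b
    fin_cases a <;> fin_cases b <;> simp [pauliY]
  have key : ∀ i j : Fin N, (if (j : ℕ) = (i : ℕ) + 1 then
      siteOp i pauliX * siteOp j pauliX + siteOp i pauliY * siteOp j pauliY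
      else 0).IsHermitian := by
    intro i j
    split_ifs with h
    · have hij : i ≠ j := by
        rintro rfl
        omega
      exact (siteOp_mul_isHermitian hij _ hX).add (siteOp_mul_isHermitian hij _ hY)
    · exact Matrix.isHermitian_zero
  unfold Matrix.IsHermitian hamiltonian
  simp only [Matrix.conjTranspose_sum]
  exact Finset.sum_congr rfl fun i _ => Finset.sum_congr rfl fun j _ => key i j

/-- The maximum transfer probability `|∑ₖ |⟨i|vₖ⟩⟨vₖ|j⟩||²`, where `v₁, …, v_N` is an
orthonormal eigenbasis of `H₁`. The spectrum of `H₁` is simple, so that the value does not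
depend on the eigenbasis. -/
def pmax (N : ℕ) (i j : Fin N) : ℝ :=
  |∑ k, ‖inner ℂ (EuclideanSpace.single i (1 : ℂ))
        ((singleHamiltonian_isHermitian N).eigenvectorBasis k) *
      inner ℂ ((singleHamiltonian_isHermitian N).eigenvectorBasis k)
        (EuclideanSpace.single j (1 : ℂ))‖| ^ 2

/-- The maximum transfer probability in the chain of `N = 2n + 1` spins between the spins at
the positions `i'` and `j'` relative to the center, which is spin `n + 1`. As `Fin N` counts
from `0`, the center has index `n`. Positions beyond the end of the chain (`n < i'` or
`n < j'`) get the value `0`; they do not matter for `n → ∞`. -/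
def pmaxCentered (n i' j' : ℕ) : ℝ :=
  if h : i' ≤ n ∧ j' ≤ n then
    pmax (2 * n + 1) ⟨n + i', by omega⟩ ⟨n + j', by omega⟩
  else 0

end

end XXChain

/-! On single excitations the chain is twice the adjacency matrix of a path, so its eigenvectors are
sines with simple spectrum (`toEuclideanLin_sineMode`, `sineMode_eigenvalue_injective`), and the
root of the transfer probability is an explicit sum of products of |sin| (`sqrt_pmax`). Measured
from the centre of a chain of length 2n+1, modes of even number become |sin| and modes of odd number
|cos|, each averaged over n+1 equidistant points (`sqrt_pmaxCentered`).

The Fourier series of |sin| and |cos| converge absolutely, and an equidistant average kills every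
fixed nonzero frequency once there are enough points. By dominated convergence only the frequency
pairs with m i + m' j = 0 survive (`tendsto_average_mul`), and these are the multiples r(b, -a) of
one primitive pair, where i : j = a : b in lowest terms. The |cos| coefficients carry a sign (-1)^m,
so the two averages combine with the weight 1 + (-1)^(r(a+b)): every r counts if a + b is even, only
even r if it is odd. This parity records whether i and j contain the same power of 2
(`even_add_div_gcd_iff`). Partial fractions and the expansion of the cotangent then sum the series
(`eq_cot_of_hasSum`). -/

namespace XXChain

/-! ### The single excitation block as a path matrix -/

/-- Matrix element of a two-site operator between single excitation states, for a one-site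
operator with vanishing diagonal. -/
theorem siteOp_mul_siteOp_excitation {N : ℕ} {a b : Fin N} (hab : a ≠ b)
    (σ : Matrix (Fin 2) (Fin 2) ℂ) (hσ : ∀ s, σ s s = 0) (i j : Fin N) :
    (siteOp a σ * siteOp b σ) (excitation i) (excitation j) =
      if (i = a ∧ j = b) ∨ (i = b ∧ j = a) then σ 1 0 * σ 0 1 else 0 := by
  have hentry : (siteOp a σ * siteOp b σ) (excitation i) (excitation j) =
      ∏ k, (if k = a ∨ k = b then σ else 1) (excitation i k) (excitation j k) := by
    rw [siteOp, siteOp, tensorOp_mul, tensorOp, Matrix.of_apply]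
    refine Finset.prod_congr rfl fun k _ => ?_
    by_cases h1 : k = a
    · have h2 : k ≠ b := fun h => hab (h1.symm.trans h)
      simp [h1, hab]
    · by_cases h2 : k = b
      · simp [h2, hab.symm]
      · simp [h1, h2]
  rw [hentry]
  split_ifs with h
  · rw [Finset.prod_eq_mul a b hab]
    · rcases h with ⟨rfl, rfl⟩ | ⟨rfl, rfl⟩
      · simp [excitation, hab, hab.symm]
      · simp [excitation, hab, hab.symm, mul_comm]
    · rintro c - ⟨hca, hcb⟩
      have hi : c ≠ i := by rintro rfl; rcases h with h | h <;> simp_all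
      have hj : c ≠ j := by rintro rfl; rcases h with h | h <;> simp_all
      have h1 : excitation i c = 0 := if_neg hi
      have h2 : excitation j c = 0 := if_neg hj
      rw [if_neg (by tauto), h1, h2, Matrix.one_apply_eq]
    · simp
    · simp
  · by_cases hij : i = j
    · subst hij
      exact Finset.prod_eq_zero (Finset.mem_univ a) (by simp [hσ])
    -- The two configurations differ exactly at `i` and `j`; an identity factor at either site makes
    -- the product vanish.
    · by_cases hi : i = a ∨ i = b
      · have hj : ¬ (j = a ∨ j = b) := by
          rcases hi with rfl | rfl <;> rintro (rfl | rfl) <;> simp_all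
        exact Finset.prod_eq_zero (Finset.mem_univ j) (by
          simp [hj, excitation, Ne.symm hij])
      · exact Finset.prod_eq_zero (Finset.mem_univ i) (by simp [hi, excitation, hij])

/-- Only the bond joining `i` and `j` can contribute; its XX and YY parts give 1 each, whence the 2.
-/
theorem singleHamiltonian_apply {N : ℕ} (i j : Fin N) :
    singleHamiltonian N i j =
      if (j : ℕ) = (i : ℕ) + 1 ∨ (i : ℕ) = (j : ℕ) + 1 then 2 else 0 := by
  have hX : ∀ s, pauliX s s = 0 := by intro s; fin_cases s <;> simp [pauliX]
  have hY : ∀ s, pauliY s s = 0 := by intro s; fin_cases s <;> simp [pauliY]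
  have hterm : ∀ a b : Fin N, ((if (b : ℕ) = (a : ℕ) + 1 then
      siteOp a pauliX * siteOp b pauliX + siteOp a pauliY * siteOp b pauliY else 0 :
        Matrix (Fin N → Fin 2) (Fin N → Fin 2) ℂ)) (excitation i) (excitation j) =
      (if a = i then if b = j then if (j : ℕ) = (i : ℕ) + 1 then 2 else 0 else 0 else 0) +
      (if a = j then if b = i then if (i : ℕ) = (j : ℕ) + 1 then 2 else 0 else 0 else 0) := by
    intro a b
    by_cases h : (b : ℕ) = (a : ℕ) + 1
    · have hab : a ≠ b := by rintro rfl; omega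
      rw [if_pos h, Matrix.add_apply, siteOp_mul_siteOp_excitation hab _ hX,
        siteOp_mul_siteOp_excitation hab _ hY]
      have h2 : pauliX 1 0 * pauliX 0 1 + pauliY 1 0 * pauliY 0 1 = 2 := by
        simp [pauliX, pauliY]; norm_num
      by_cases h3 : i = a ∧ j = b
      · obtain ⟨rfl, rfl⟩ := h3
        simp only [true_and, true_or, if_true, h2, h]
        simp [hab]
      · by_cases h4 : i = b ∧ j = a
        · obtain ⟨rfl, rfl⟩ := h4
          simp only [true_and, or_true, if_true, h2, h]
          simp [hab]
        · rw [if_neg (by tauto), if_neg (by tauto)]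
          grind
    · rw [if_neg h, Matrix.zero_apply]
      grind
  rw [singleHamiltonian, Matrix.submatrix_apply, hamiltonian]
  simp only [Matrix.sum_apply, hterm]
  simp only [Finset.sum_add_distrib, Finset.sum_ite_eq', Finset.sum_ite_irrel,
    Finset.sum_const_zero, Finset.mem_univ, if_true]
  split_ifs <;> first | omega | simp

/-- `H₁` acts as twice the discrete path operator on sequences vanishing at both ends. -/
theorem singleHamiltonian_mulVec {N : ℕ} (f : ℕ → ℂ) (h0 : f 0 = 0) (hN : f (N + 1) = 0)
    (i : Fin N) :
    (singleHamiltonian N *ᵥ fun l : Fin N => f (l + 1)) i = 2 * (f i + f (i + 2)) := by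
  obtain ⟨i, hi⟩ := i
  simp only [Matrix.mulVec, dotProduct, singleHamiltonian_apply]
  rw [Fin.sum_univ_eq_sum_range
    (fun j => (if j = i + 1 ∨ i = j + 1 then (2 : ℂ) else 0) * f (j + 1)) N]
  -- The guard `0 < i` is needed because `i - 1` truncates to 0 at the left end, where there is no
  -- left neighbour.
  have hsplit : ∀ j, (if j = i + 1 ∨ i = j + 1 then (2 : ℂ) else 0) * f (j + 1) =
      (if i + 1 = j then 2 * f (j + 1) else 0) +
        (if i - 1 = j then if 0 < i then 2 * f (j + 1) else 0 else 0) := by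
    intro j
    split_ifs <;> first | omega | simp
  simp only [hsplit, Finset.sum_add_distrib, Finset.sum_ite_eq, Finset.mem_range]
  have e1 : (if i + 1 < N then 2 * f (i + 1 + 1) else 0) = 2 * f (i + 2) := by
    split_ifs with h
    · rfl
    · rw [show i + 2 = N + 1 by omega, hN, mul_zero]
  have e2 : (if i - 1 < N then if 0 < i then 2 * f (i - 1 + 1) else 0 else 0) = 2 * f i := by
    rw [if_pos (by omega)]
    split_ifs with h
    · rw [Nat.sub_add_cancel h]
    · rw [show i = 0 by omega, h0, mul_zero]
  rw [e1, e2]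
  ring

/-! ### Independence of the eigenbasis -/

/-- Eigenvectors of a symmetric operator for different eigenvalues are orthogonal. -/
theorem inner_eq_zero_of_eigenvalue_ne {E : Type*} [NormedAddCommGroup E]
    [InnerProductSpace ℂ E] {T : E →ₗ[ℂ] E} (hT : T.IsSymmetric) {x y : E} {a b : ℝ}
    (hx : T x = (a : ℂ) • x) (hy : T y = (b : ℂ) • y) (hab : a ≠ b) : inner ℂ x y = 0 := by
  have h := hT x y
  rw [hx, hy, inner_smul_left, inner_smul_right, Complex.conj_ofReal] at h
  have h2 : ((a : ℂ) - b) * inner ℂ x y = 0 := by rw [sub_mul, h, sub_self]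
  rcases mul_eq_zero.mp h2 with h3 | h3
  · exact absurd (by exact_mod_cast sub_eq_zero.mp h3) hab
  · exact h3

/-- If a symmetric operator has an orthonormal eigenbasis `u` with pairwise different eigenvalues,
then sums of phase invariant functions over any orthonormal eigenbasis are sums over `u`. -/
theorem sum_orthonormal_eigenbasis_eq {ι E : Type*} [Fintype ι] [NormedAddCommGroup E]
    [InnerProductSpace ℂ E] {T : E →ₗ[ℂ] E} (hT : T.IsSymmetric)
    (u v : OrthonormalBasis ι ℂ E) (μ ν : ι → ℝ) (hμ : Function.Injective μ)
    (hu : ∀ k, T (u k) = (μ k : ℂ) • u k) (hv : ∀ k, T (v k) = (ν k : ℂ) • v k)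
    (g : E → ℝ) (hg : ∀ (c : ℂ) (x : E), ‖c‖ = 1 → g (c • x) = g x) :
    ∑ k, g (v k) = ∑ k, g (u k) := by
  classical
  have hex : ∀ k, ∃ q, ∃ c : ℂ, ‖c‖ = 1 ∧ v k = c • u q := by
    intro k
    have hne : ∃ q, inner ℂ (u q) (v k) ≠ 0 := by
      by_contra! hall
      have h0 : v k = 0 := by
        rw [← u.sum_repr' (v k)]
        simp [hall]
      have h1 := v.orthonormal.1 k
      simp [h0] at h1
    obtain ⟨q, hq⟩ := hne
    -- A nonzero overlap forces equal eigenvalues; since `μ` is injective, no other `u p` can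
    -- overlap with `v k`.
    have hμν : μ q = ν k := by
      by_contra h
      exact hq (inner_eq_zero_of_eigenvalue_ne hT (hu q) (hv k) h)
    have hk : v k = inner ℂ (u q) (v k) • u q := by
      conv_lhs => rw [← u.sum_repr' (v k)]
      refine Finset.sum_eq_single q (fun p _ hp => ?_) (by simp)
      rw [inner_eq_zero_of_eigenvalue_ne hT (hu p) (hv k)
        (fun h => hp (hμ (h.trans hμν.symm))), zero_smul]
    refine ⟨q, _, ?_, hk⟩
    have h1 := v.orthonormal.1 k
    rw [hk, norm_smul, u.orthonormal.1 q, mul_one] at h1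
    exact h1
  choose s c hc hs using hex
  -- Two vectors of `v` proportional to the same `u q` could not be orthogonal.
  have hinj : Function.Injective s := by
    intro k l hkl
    by_contra hne
    have h : inner ℂ (v k) (v l) = 0 := v.orthonormal.2 hne
    rw [hs k, hs l, hkl, inner_smul_left, inner_smul_right, inner_self_eq_norm_sq_to_K,
      u.orthonormal.1 (s l)] at h
    have hk : c k ≠ 0 := fun h0 => by simpa [h0] using hc k
    have hl : c l ≠ 0 := fun h0 => by simpa [h0] using hc l
    simp [hk, hl] at h
  rw [← (Equiv.ofBijective s (Finite.injective_iff_bijective.mp hinj)).sum_comp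
    (fun k => g (u k))]
  refine Finset.sum_congr rfl fun k _ => ?_
  rw [hs k, hg _ _ (hc k)]
  rfl

/-! ### The sine eigenbasis -/

/-- Sums of the powers of a root of unity. -/
theorem sum_exp_two_pi_div {M : ℕ} (hM : 0 < M) (p : ℤ) (hp : ¬ (M : ℤ) ∣ p) :
    ∑ k ∈ Finset.range M, Complex.exp (2 * Real.pi * Complex.I * p * k / M) = 0 := by
  have hM' : (M : ℂ) ≠ 0 := by exact_mod_cast hM.ne'
  set z := Complex.exp (2 * Real.pi * Complex.I * p / M) with hz
  have hterm : ∀ k : ℕ, Complex.exp (2 * Real.pi * Complex.I * p * k / M) = z ^ k := by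
    intro k
    rw [hz, ← Complex.exp_nat_mul]
    congr 1
    ring
  have hz1 : z ≠ 1 := by
    intro h
    obtain ⟨n, hn⟩ := Complex.exp_eq_one_iff.mp h
    have hpi : (2 * Real.pi * Complex.I : ℂ) ≠ 0 := Complex.two_pi_I_ne_zero
    have h2 : (p : ℂ) = n * M := by
      rw [div_eq_iff hM'] at hn
      apply mul_left_cancel₀ hpi
      rw [hn]; ring
    exact hp ⟨n, by rw [mul_comm]; exact_mod_cast h2⟩
  have hzM : z ^ M = 1 := by
    rw [hz, ← Complex.exp_nat_mul, Complex.exp_eq_one_iff]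
    exact ⟨p, by field_simp⟩
  simp only [hterm]
  rw [geom_sum_eq hz1, hzM, sub_self, zero_div]

theorem sum_sin_sq {N : ℕ} (q : Fin N) :
    ∑ l : Fin N, Real.sin (Real.pi * (q + 1) / (N + 1) * (l + 1)) ^ 2 = ((N : ℝ) + 1) / 2 := by
  have hcos : ∑ k ∈ Finset.range (N + 1),
      Real.cos (2 * (Real.pi * (q + 1) / (N + 1) * k)) = 0 := by
    have h := sum_exp_two_pi_div (Nat.succ_pos N) (q + 1) (by
      intro h
      have := Int.le_of_dvd (by positivity) h
      have := q.2
      push_cast at *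
      omega)
    have h2 := congrArg Complex.re h
    rw [Complex.re_sum] at h2
    rw [Complex.zero_re] at h2
    rw [← h2]
    refine Finset.sum_congr rfl fun k _ => ?_
    rw [← Complex.exp_ofReal_mul_I_re]
    congr 2
    push_cast
    ring
  rw [Fin.sum_univ_eq_sum_range
    (fun l => Real.sin (Real.pi * (q + 1) / (N + 1) * ((l : ℝ) + 1)) ^ 2) N]
  -- Adding the vanishing term at 0 completes a full period of N + 1 points, over which the
  -- double-angle cosines cancel.
  have h3 : ∑ k ∈ Finset.range (N + 1), Real.sin (Real.pi * (q + 1) / (N + 1) * k) ^ 2 =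
      ((N : ℝ) + 1) / 2 := by
    simp only [Real.sin_sq_eq_half_sub]
    rw [Finset.sum_sub_distrib, ← Finset.sum_div, ← Finset.sum_div, hcos]
    simp
  rw [Finset.sum_range_succ'] at h3
  simpa using h3

/-- The normalized sine eigenvectors of `H₁`. -/
noncomputable def sineMode (N : ℕ) (q : Fin N) : EuclideanSpace ℂ (Fin N) :=
  WithLp.toLp 2 fun l =>
    ((Real.sqrt (2 / (N + 1)) * Real.sin (Real.pi * (q + 1) / (N + 1) * (l + 1)) : ℝ) : ℂ)

theorem norm_sineMode {N : ℕ} (q : Fin N) : ‖sineMode N q‖ = 1 := by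
  have hN : (0 : ℝ) < N + 1 := by positivity
  have h : ‖sineMode N q‖ ^ 2 = 1 := by
    rw [EuclideanSpace.norm_sq_eq]
    simp only [sineMode, Complex.norm_real, Real.norm_eq_abs, sq_abs, mul_pow]
    rw [← Finset.mul_sum, sum_sin_sq, Real.sq_sqrt (by positivity)]
    field_simp
  exact (pow_eq_one_iff_of_nonneg (norm_nonneg _) two_ne_zero).mp h

theorem toEuclideanLin_sineMode {N : ℕ} (q : Fin N) :
    Matrix.toEuclideanLin (singleHamiltonian N) (sineMode N q) =
      ((4 * Real.cos (Real.pi * (q + 1) / (N + 1)) : ℝ) : ℂ) • sineMode N q := by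
  have hN : ((N : ℝ) + 1) ≠ 0 := by positivity
  ext i
  set θ := Real.pi * (q + 1) / (N + 1) with hθ
  have h := singleHamiltonian_mulVec (N := N)
    (fun l => ((Real.sqrt (2 / (N + 1)) * Real.sin (θ * l) : ℝ) : ℂ)) (by simp) (by
      have : θ * ((N + 1 : ℕ) : ℝ) = ((q + 1 : ℕ) : ℝ) * Real.pi := by
        rw [hθ]; push_cast; field_simp
      simp only [this, Real.sin_nat_mul_pi, mul_zero, Complex.ofReal_zero]) i
  have hfun : (fun l : Fin N =>
      ((Real.sqrt (2 / (N + 1)) * Real.sin (θ * ((l + 1 : ℕ) : ℝ)) : ℝ) : ℂ)) =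
      (sineMode N q).ofLp := by
    ext l
    simp only [sineMode, ← hθ]
    push_cast
    ring_nf
  rw [hfun] at h
  rw [Matrix.toLpLin_apply]
  change (singleHamiltonian N *ᵥ (sineMode N q).ofLp) i = _
  rw [h]
  simp only [PiLp.smul_apply, sineMode, smul_eq_mul, ← hθ]
  norm_cast
  have h1 : θ * ((i : ℕ) : ℝ) = θ * (((i : ℕ) : ℝ) + 1) - θ := by ring
  have h2 : θ * (((i + 2 : ℕ)) : ℝ) = θ * (((i : ℕ) : ℝ) + 1) + θ := by push_cast; ring
  rw [h1, h2, Real.sin_sub, Real.sin_add]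
  push_cast
  ring

theorem sineMode_eigenvalue_injective (N : ℕ) :
    Function.Injective fun q : Fin N => 4 * Real.cos (Real.pi * (q + 1) / (N + 1)) := by
  intro q r h
  have hmem : ∀ q : Fin N, Real.pi * (q + 1) / (N + 1) ∈ Set.Icc 0 Real.pi := by
    intro q
    have hq : ((q : ℕ) : ℝ) < N := by exact_mod_cast q.2
    refine ⟨by positivity, ?_⟩
    rw [div_le_iff₀ (by positivity)]
    exact mul_le_mul_of_nonneg_left (by linarith) Real.pi_pos.le
  have h2 := Real.injOn_cos (hmem q) (hmem r) (mul_left_cancel₀ four_ne_zero h)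
  have hN : ((N : ℝ) + 1) ≠ 0 := by positivity
  rw [div_left_inj' hN] at h2
  have h3 := mul_left_cancel₀ Real.pi_ne_zero h2
  have h4 : ((q : ℕ) : ℝ) = (r : ℕ) := by linarith
  exact Fin.ext (by exact_mod_cast h4)

/-- The summand is unchanged when an eigenvector is multiplied by a phase, so the eigenbasis used in
`pmax` may be replaced by the sine modes. -/
theorem sqrt_pmax {N : ℕ} (i j : Fin N) :
    Real.sqrt (pmax N i j) = 2 / ((N : ℝ) + 1) * ∑ q : Fin N,
      |Real.sin (Real.pi * (q + 1) / (N + 1) * (i + 1)) *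
        Real.sin (Real.pi * (q + 1) / (N + 1) * (j + 1))| := by
  have hT := Matrix.isSymmetric_toEuclideanLin_iff.mpr (singleHamiltonian_isHermitian N)
  have hon : Orthonormal ℂ (sineMode N) := by
    refine ⟨norm_sineMode, fun q r hqr => ?_⟩
    exact inner_eq_zero_of_eigenvalue_ne hT (toEuclideanLin_sineMode q)
      (toEuclideanLin_sineMode r) fun h => hqr (sineMode_eigenvalue_injective N h)
  have : Nonempty (Fin N) := ⟨i⟩
  let u : OrthonormalBasis (Fin N) ℂ (EuclideanSpace ℂ (Fin N)) :=
    (basisOfOrthonormalOfCardEqFinrank hon (by simp)).toOrthonormalBasis (by simpa using hon)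
  have hu : ∀ q, u q = sineMode N q := by intro q; simp [u]
  have hsum := sum_orthonormal_eigenbasis_eq hT u
    (singleHamiltonian_isHermitian N).eigenvectorBasis _
    (singleHamiltonian_isHermitian N).eigenvalues (sineMode_eigenvalue_injective N)
    (fun q => by rw [hu]; exact toEuclideanLin_sineMode q)
    (fun k => by
      rw [Matrix.toLpLin_apply]
      ext l
      have := congrFun ((singleHamiltonian_isHermitian N).mulVec_eigenvectorBasis k) l
      simpa using this)
    (fun x => ‖inner ℂ (EuclideanSpace.single i (1 : ℂ)) x *
      inner ℂ x (EuclideanSpace.single j (1 : ℂ))‖)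
    (fun c x hc => by
      simp only [inner_smul_left, inner_smul_right, norm_mul, RCLike.norm_conj, hc, one_mul])
  rw [pmax, Real.sqrt_sq (abs_nonneg _), hsum, abs_of_nonneg (by positivity), Finset.mul_sum]
  refine Finset.sum_congr rfl fun q _ => ?_
  have hs : Real.sqrt (2 / ((N : ℝ) + 1)) * Real.sqrt (2 / ((N : ℝ) + 1)) = 2 / ((N : ℝ) + 1) :=
    Real.mul_self_sqrt (by positivity)
  rw [hu, EuclideanSpace.inner_single_left, EuclideanSpace.inner_single_right]
  simp only [sineMode, map_one, one_mul, norm_mul, RCLike.norm_conj, Complex.norm_real,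
    Real.norm_eq_abs, abs_mul, abs_of_nonneg (Real.sqrt_nonneg _)]
  linear_combination (|Real.sin (Real.pi * (q + 1) / (N + 1) * (i + 1))| *
    |Real.sin (Real.pi * (q + 1) / (N + 1) * (j + 1))|) * hs

/-! ### Fourier series of |sin| and |cos| -/

/-- The Fourier coefficients of `|sin|`, as a function of period `π`. -/
noncomputable def absSinCoeff (m : ℤ) : ℝ := -2 / (Real.pi * (4 * (m : ℝ) ^ 2 - 1))

theorem integral_exp_mul_sin (m : ℤ) :
    ∫ x in (0 : ℝ)..Real.pi, Complex.exp (-2 * Complex.I * m * x) * (Real.sin x : ℂ) =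
      -2 / (4 * (m : ℂ) ^ 2 - 1) := by
  have hp : (2 * (m : ℂ) + 1) ≠ 0 := by
    have : (2 * m + 1 : ℤ) ≠ 0 := by omega
    exact_mod_cast this
  have hm : (2 * (m : ℂ) - 1) ≠ 0 := by
    have : (2 * m - 1 : ℤ) ≠ 0 := by omega
    exact_mod_cast this
  have hc1 : -Complex.I * (2 * (m : ℂ) + 1) ≠ 0 := mul_ne_zero (by simp) hp
  have hc2 : -Complex.I * (2 * (m : ℂ) - 1) ≠ 0 := mul_ne_zero (by simp) hm
  have hfun : ∀ x : ℝ, Complex.exp (-2 * Complex.I * m * x) * (Real.sin x : ℂ) =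
      Complex.I / 2 * (Complex.exp (-Complex.I * (2 * (m : ℂ) + 1) * x) -
        Complex.exp (-Complex.I * (2 * (m : ℂ) - 1) * x)) := by
    intro x
    rw [Complex.ofReal_sin, Complex.sin]
    have e1 : -Complex.I * (2 * (m : ℂ) + 1) * x =
      -2 * Complex.I * m * x + -x * Complex.I := by ring
    have e2 : -Complex.I * (2 * (m : ℂ) - 1) * x =
      -2 * Complex.I * m * x + x * Complex.I := by ring
    rw [e1, e2, Complex.exp_add, Complex.exp_add]
    ring
  have hexp : ∀ k : ℤ, Complex.exp (-Complex.I * (2 * (k : ℂ) + 1) * Real.pi) = -1 := by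
    intro k
    have : -Complex.I * (2 * (k : ℂ) + 1) * Real.pi =
      Real.pi * Complex.I + ((-k - 1 : ℤ) : ℂ) * (2 * Real.pi * Complex.I) := by
      push_cast; ring
    rw [this, Complex.exp_add, Complex.exp_int_mul_two_pi_mul_I, mul_one, Complex.exp_pi_mul_I]
  have hexp2 : Complex.exp (-Complex.I * (2 * (m : ℂ) - 1) * Real.pi) = -1 := by
    rw [← hexp (m - 1)]
    congr 1
    push_cast
    ring
  simp only [hfun]
  rw [intervalIntegral.integral_const_mul, intervalIntegral.integral_sub
    (Continuous.intervalIntegrable (by fun_prop) _ _)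
    (Continuous.intervalIntegrable (by fun_prop) _ _),
    integral_exp_mul_complex hc1, integral_exp_mul_complex hc2, hexp m, hexp2]
  have h4 : (4 * (m : ℂ) ^ 2 - 1) = (2 * m + 1) * (2 * m - 1) := by ring
  rw [h4]
  simp only [Complex.ofReal_zero, mul_zero, Complex.exp_zero]
  field_simp
  ring

theorem summable_absSinCoeff : Summable absSinCoeff := by
  have h := (Real.summable_one_div_int_pow (p := 2)).mpr one_lt_two
  refine Summable.of_norm_bounded_eventually h ?_
  rw [Filter.eventually_cofinite]
  -- The comparison with `1 / m ^ 2` fails only at `m = 0`, where Lean's division makes the bound 0.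
  refine (Set.finite_singleton (0 : ℤ)).subset fun m hm => ?_
  by_contra hm0
  apply hm
  have h1 : (1 : ℝ) ≤ (m : ℝ) ^ 2 := by
    have : (1 : ℤ) ≤ m ^ 2 := by
      have : m ≠ 0 := hm0
      have : 0 < m ^ 2 := by positivity
      omega
    exact_mod_cast this
  have hpi := Real.pi_gt_three
  rw [absSinCoeff, norm_div, norm_neg, Real.norm_of_nonneg zero_le_two,
    Real.norm_of_nonneg (by nlinarith), div_le_div_iff₀ (by nlinarith) (by linarith)]
  nlinarith

theorem hasSum_abs_sin (t : ℝ) :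
    HasSum (fun m : ℤ => (absSinCoeff m : ℂ) * Complex.exp (2 * Complex.I * m * t))
      (|Real.sin t| : ℝ) := by
  have : Fact (0 < Real.pi) := ⟨Real.pi_pos⟩
  have hper : Function.Periodic (fun x : ℝ => ((|Real.sin x| : ℝ) : ℂ)) Real.pi := by
    intro x
    simp [Real.sin_add_pi]
  have hcont : Continuous (fun x : ℝ => ((|Real.sin x| : ℝ) : ℂ)) := by fun_prop
  let f : C(AddCircle Real.pi, ℂ) :=
    ⟨hper.lift, continuous_coinduced_dom.mpr hcont⟩
  have hfx : ∀ x : ℝ, f (x : AddCircle Real.pi) = ((|Real.sin x| : ℝ) : ℂ) := fun x =>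
    hper.lift_coe x
  have hpi : (Real.pi : ℂ) ≠ 0 := by exact_mod_cast Real.pi_ne_zero
  have hcoeff : ∀ m, fourierCoeff f m = (absSinCoeff m : ℂ) := by
    intro m
    rw [fourierCoeff_eq_intervalIntegral f m 0, zero_add]
    have hint : ∫ x in (0 : ℝ)..Real.pi, fourier (-m) (x : AddCircle Real.pi) • f x =
        ∫ x in (0 : ℝ)..Real.pi, Complex.exp (-2 * Complex.I * m * x) * (Real.sin x : ℂ) := by
      refine intervalIntegral.integral_congr fun x hx => ?_
      rw [Set.uIcc_of_le Real.pi_pos.le] at hx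
      simp only [smul_eq_mul]
      rw [hfx, fourier_coe_apply, abs_of_nonneg (Real.sin_nonneg_of_mem_Icc hx)]
      congr 2
      push_cast
      field_simp
    rw [hint, integral_exp_mul_sin, absSinCoeff, Complex.real_smul]
    push_cast
    rw [← div_div, div_mul_div_comm, one_mul, div_div]
  have hsum : Summable (fourierCoeff f) := by
    have : fourierCoeff f = fun m => (absSinCoeff m : ℂ) := funext hcoeff
    rw [this]
    exact_mod_cast summable_absSinCoeff
  have h := has_pointwise_sum_fourier_series_of_summable hsum (t : AddCircle Real.pi)
  rw [hfx] at h
  convert h using 2 with m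
  rw [hcoeff, fourier_coe_apply, smul_eq_mul]
  congr 2
  field_simp

/-- A shift by π/2 turns |sin| into |cos| and multiplies the m-th character by exp(iπm), the sign
that later separates the two cases. -/
theorem hasSum_abs_cos (t : ℝ) :
    HasSum (fun m : ℤ => ((-1) ^ m * absSinCoeff m : ℂ) * Complex.exp (2 * Complex.I * m * t))
      (|Real.cos t| : ℝ) := by
  have h := hasSum_abs_sin (t + Real.pi / 2)
  rw [Real.sin_add_pi_div_two] at h
  convert h using 2 with m
  have he : Complex.exp (2 * Complex.I * m * ((t + Real.pi / 2 : ℝ) : ℂ)) =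
      (-1) ^ m * Complex.exp (2 * Complex.I * m * t) := by
    rw [← Complex.exp_pi_mul_I, ← Complex.exp_int_mul, ← Complex.exp_add]
    congr 1
    push_cast
    ring
  rw [he]
  ring

/-! ### Equidistant averages and resonant frequencies -/

open Filter Topology

/-- The average of the character of frequency `q` over `M` equidistant points of a period,
shifted by `δ` steps. -/
noncomputable def charAverage (δ : ℝ) (M : ℕ) (q : ℤ) : ℂ :=
  (1 / M : ℂ) * ∑ k ∈ Finset.range M,
    Complex.exp (2 * Complex.I * q * ((Real.pi * (k + δ) / M : ℝ) : ℂ))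

theorem norm_charAverage_le (δ : ℝ) (M : ℕ) (q : ℤ) : ‖charAverage δ M q‖ ≤ 1 := by
  have hexp : ∀ x : ℝ, ‖Complex.exp (2 * Complex.I * q * (x : ℂ))‖ = 1 := by
    intro x
    have : 2 * Complex.I * q * (x : ℂ) = ((2 * q * x : ℝ) : ℂ) * Complex.I := by
      push_cast; ring
    rw [this, Complex.norm_exp_ofReal_mul_I]
  have hsum : ‖∑ k ∈ Finset.range M,
      Complex.exp (2 * Complex.I * q * ((Real.pi * (k + δ) / M : ℝ) : ℂ))‖ ≤ M := by
    refine (norm_sum_le _ _).trans ?_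
    simp only [hexp]
    simp
  rw [charAverage, norm_mul, norm_div, norm_one, Complex.norm_natCast, one_div]
  exact inv_mul_le_one_of_le₀ hsum (Nat.cast_nonneg M)

theorem tendsto_charAverage (δ : ℝ) (q : ℤ) :
    Tendsto (fun M => charAverage δ M q) atTop (𝓝 (if q = 0 then 1 else 0)) := by
  refine tendsto_const_nhds.congr' ?_
  -- For M > |q|, M divides q only if q = 0, so the average already equals its limit.
  filter_upwards [eventually_gt_atTop q.natAbs] with M hM
  have hM0 : 0 < M := by omega
  have hM' : (M : ℂ) ≠ 0 := by exact_mod_cast hM0.ne'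
  split_ifs with hq
  · subst hq
    simp [charAverage, hM']
  · have hdvd : ¬ (M : ℤ) ∣ q := by
      intro h
      have := Int.natAbs_dvd_natAbs.mpr h
      have := Nat.le_of_dvd (by omega) this
      simp at this
      omega
    have hterm : ∀ k : ℕ, Complex.exp (2 * Complex.I * q * ((Real.pi * (k + δ) / M : ℝ) : ℂ)) =
        Complex.exp (2 * Complex.I * q * (Real.pi * δ / M)) *
          Complex.exp (2 * Real.pi * Complex.I * q * k / M) := by
      intro k
      rw [← Complex.exp_add]
      congr 1
      push_cast
      ring
    simp only [charAverage, hterm]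
    rw [← Finset.mul_sum, sum_exp_two_pi_div hM0 q hdvd, mul_zero, mul_zero]

/-- Averages over equidistant points of the product of two dilates of an absolutely convergent
Fourier series converge to the sum over the resonant frequencies. -/
theorem tendsto_average_mul {A : ℤ → ℂ} (hA : Summable fun m => ‖A m‖) {F : ℝ → ℂ}
    (hF : ∀ t : ℝ, HasSum (fun m : ℤ => A m * Complex.exp (2 * Complex.I * m * (t : ℂ))) (F t))
    (δ : ℝ) (i j : ℕ) :
    Tendsto (fun M : ℕ => (1 / M : ℂ) * ∑ k ∈ Finset.range M,
        F (Real.pi * (k + δ) / M * i) * F (Real.pi * (k + δ) / M * j)) atTop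
      (𝓝 (∑' p : ℤ × ℤ, if p.1 * i + p.2 * j = 0 then A p.1 * A p.2 else 0)) := by
  have hnorm : ∀ (m : ℤ) (t : ℝ), ‖A m * Complex.exp (2 * Complex.I * m * t)‖ = ‖A m‖ := by
    intro m t
    have : 2 * Complex.I * m * (t : ℂ) = ((2 * m * t : ℝ) : ℂ) * Complex.I := by
      push_cast; ring
    rw [norm_mul, this, Complex.norm_exp_ofReal_mul_I, mul_one]
  have hsummable : ∀ t : ℝ,
      Summable fun m : ℤ => ‖A m * Complex.exp (2 * Complex.I * m * t)‖ := by
    intro t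
    simpa only [hnorm] using hA
  have hprod : ∀ x : ℝ, HasSum (fun p : ℤ × ℤ => A p.1 * A p.2 *
      Complex.exp (2 * Complex.I * ((p.1 * i + p.2 * j : ℤ) : ℂ) * x)) (F (x * i) * F (x * j)) := by
    intro x
    have hs : Summable fun p : ℤ × ℤ =>
        (A p.1 * Complex.exp (2 * Complex.I * p.1 * ((x * i : ℝ) : ℂ))) *
          (A p.2 * Complex.exp (2 * Complex.I * p.2 * ((x * j : ℝ) : ℂ))) :=
      summable_mul_of_summable_norm
        (f := fun m : ℤ => A m * Complex.exp (2 * Complex.I * m * ((x * i : ℝ) : ℂ)))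
        (g := fun m : ℤ => A m * Complex.exp (2 * Complex.I * m * ((x * j : ℝ) : ℂ)))
        (hsummable (x * i)) (hsummable (x * j))
    have h := (hF (x * i)).mul (hF (x * j)) hs
    refine h.congr_fun fun p => ?_
    have he : 2 * Complex.I * ((p.1 * i + p.2 * j : ℤ) : ℂ) * x =
        2 * Complex.I * p.1 * ((x * i : ℝ) : ℂ) + 2 * Complex.I * p.2 * ((x * j : ℝ) : ℂ) := by
      push_cast; ring
    rw [he, Complex.exp_add]
    ring
  have havg : ∀ M : ℕ, HasSum (fun p : ℤ × ℤ => A p.1 * A p.2 *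
      charAverage δ M (p.1 * i + p.2 * j)) ((1 / M : ℂ) * ∑ k ∈ Finset.range M,
        F (Real.pi * (k + δ) / M * i) * F (Real.pi * (k + δ) / M * j)) := by
    intro M
    have h := (hasSum_sum (s := Finset.range M) fun k _ =>
      hprod (Real.pi * (k + δ) / M)).mul_left (1 / M : ℂ)
    refine h.congr_fun fun p => ?_
    rw [charAverage, ← Finset.mul_sum]
    ring
  have htsum := fun M => (havg M).tsum_eq
  simp only [← htsum]
  refine tendsto_tsum_of_dominated_convergence (bound := fun p : ℤ × ℤ => ‖A p.1‖ * ‖A p.2‖)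
    (hA.mul_of_nonneg hA (fun _ => norm_nonneg _) (fun _ => norm_nonneg _)) (fun p => ?_) ?_
  · have h := (tendsto_charAverage δ (p.1 * i + p.2 * j)).const_mul (A p.1 * A p.2)
    simpa using h
  · refine Eventually.of_forall fun M p => ?_
    rw [norm_mul, norm_mul]
    exact mul_le_of_le_one_right (by positivity) (norm_charAverage_le _ _ _)

/-- The pairs of integers orthogonal to `(i, j)` are the multiples of one primitive pair. -/
theorem tsum_resonant (A : ℤ → ℂ) {i j : ℕ} (hi : 0 < i) :
    (∑' p : ℤ × ℤ, if p.1 * i + p.2 * j = 0 then A p.1 * A p.2 else 0) =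
      ∑' r : ℤ, A (r * (j / Nat.gcd i j : ℕ)) * A (-(r * (i / Nat.gcd i j : ℕ))) := by
  obtain ⟨g, a, b, hg, hab, rfl, rfl⟩ := Nat.exists_coprime' (Nat.gcd_pos_of_pos_left j hi)
  have ha : 0 < a := Nat.pos_of_mul_pos_right hi
  have hgcd : Nat.gcd (a * g) (b * g) = g := by
    rw [Nat.gcd_mul_right, hab, one_mul]
  rw [hgcd, Nat.mul_div_cancel _ hg, Nat.mul_div_cancel _ hg]
  have hga : (g : ℤ) ≠ 0 := by exact_mod_cast hg.ne'
  have ha' : (a : ℤ) ≠ 0 := by exact_mod_cast ha.ne'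
  have hinj : Function.Injective fun r : ℤ => (r * (b : ℤ), -(r * (a : ℤ))) := by
    intro r s h
    have h2 := neg_injective (Prod.mk.inj h).2
    exact mul_right_cancel₀ ha' h2
  rw [← hinj.tsum_eq]
  · refine tsum_congr fun r => ?_
    rw [if_pos (by push_cast; ring)]
  · intro p hp
    have hp0 : p.1 * ((a * g : ℕ) : ℤ) + p.2 * ((b * g : ℕ) : ℤ) = 0 := by
      by_contra h
      exact hp (if_neg h)
    have hlin : p.1 * (a : ℤ) = -p.2 * b := by
      apply mul_right_cancel₀ hga
      push_cast at hp0
      linear_combination hp0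
    -- Coprimality of `a` and `b` yields the multiplier r as `-p.2 / a`.
    have hdvd : (a : ℤ) ∣ -p.2 := by
      have : IsCoprime (a : ℤ) b := Nat.isCoprime_iff_coprime.mpr hab
      exact this.dvd_of_dvd_mul_right ⟨p.1, by rw [← hlin]; ring⟩
    obtain ⟨r, hr⟩ := hdvd
    refine ⟨r, Prod.ext ?_ ?_⟩
    · apply mul_right_cancel₀ ha'
      simp only
      rw [hlin, hr]; ring
    · simp only
      linear_combination hr

/-! ### The limit as a sum over resonances -/

theorem sum_range_two_mul (g : ℕ → ℝ) (M : ℕ) :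
    ∑ k ∈ Finset.range (2 * M), g k =
      ∑ k ∈ Finset.range M, g (2 * k) + ∑ k ∈ Finset.range M, g (2 * k + 1) := by
  induction M with
  | zero => simp
  | succ M ih =>
    rw [show 2 * (M + 1) = 2 * M + 1 + 1 by ring, Finset.sum_range_succ, Finset.sum_range_succ, ih,
      Finset.sum_range_succ, Finset.sum_range_succ]
    ring

theorem abs_sin_nat_mul_pi_add (k : ℕ) (x : ℝ) : |Real.sin (k * Real.pi + x)| = |Real.sin x| := by
  rw [add_comm, Real.sin_add_nat_mul_pi, abs_mul, abs_pow, abs_neg, abs_one, one_pow, one_mul]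

/-- The site at distance l from the centre has coordinate (n+1) + l. In mode 2k the part n+1
contributes the phase kπ, invisible to |sin|; in mode 2k+1 it contributes kπ + π/2, which turns sine
into cosine. -/
theorem sqrt_pmaxCentered {n i j : ℕ} (hi : i ≤ n) (hj : j ≤ n) :
    Real.sqrt (pmaxCentered n i j) =
      1 / ((n + 1 : ℕ) : ℝ) * ∑ k ∈ Finset.range (n + 1),
        |Real.sin (Real.pi * (k + 0) / ((n + 1 : ℕ) : ℝ) * i)| *
          |Real.sin (Real.pi * (k + 0) / ((n + 1 : ℕ) : ℝ) * j)| +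
      1 / ((n + 1 : ℕ) : ℝ) * ∑ k ∈ Finset.range (n + 1),
        |Real.cos (Real.pi * (k + 1 / 2) / ((n + 1 : ℕ) : ℝ) * i)| *
          |Real.cos (Real.pi * (k + 1 / 2) / ((n + 1 : ℕ) : ℝ) * j)| := by
  rw [pmaxCentered, dif_pos ⟨hi, hj⟩, sqrt_pmax]
  have hM : ((n : ℝ) + 1) ≠ 0 := by positivity
  have heven : ∀ k l : ℕ, |Real.sin (Real.pi * ((2 * k : ℕ) : ℝ) / (2 * (n + 1)) * (n + l + 1))| =
      |Real.sin (Real.pi * (k + 0) / ((n + 1 : ℕ) : ℝ) * l)| := by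
    intro k l
    rw [← abs_sin_nat_mul_pi_add k (Real.pi * (k + 0) / ((n + 1 : ℕ) : ℝ) * l)]
    congr 2
    push_cast
    field_simp
    ring
  have hodd : ∀ k l : ℕ,
      |Real.sin (Real.pi * ((2 * k + 1 : ℕ) : ℝ) / (2 * (n + 1)) * (n + l + 1))| =
      |Real.cos (Real.pi * (k + 1 / 2) / ((n + 1 : ℕ) : ℝ) * l)| := by
    intro k l
    rw [← Real.sin_add_pi_div_two, ← abs_sin_nat_mul_pi_add k
      (Real.pi * (k + 1 / 2) / ((n + 1 : ℕ) : ℝ) * l + Real.pi / 2)]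
    congr 2
    push_cast
    field_simp
    ring
  set g : ℕ → ℝ := fun k => |Real.sin (Real.pi * (k : ℝ) / (2 * (n + 1)) * (n + i + 1))| *
    |Real.sin (Real.pi * (k : ℝ) / (2 * (n + 1)) * (n + j + 1))| with hg
  have hsum : ∑ q : Fin (2 * n + 1),
      |Real.sin (Real.pi * (q + 1) / (((2 * n + 1 : ℕ) : ℝ) + 1) * (((n + i : ℕ) : ℝ) + 1)) *
        Real.sin (Real.pi * (q + 1) / (((2 * n + 1 : ℕ) : ℝ) + 1) * (((n + j : ℕ) : ℝ) + 1))| =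
      ∑ k ∈ Finset.range (2 * (n + 1)), g k := by
    rw [show 2 * (n + 1) = 2 * n + 1 + 1 by ring, Finset.sum_range_succ',
      ← Fin.sum_univ_eq_sum_range (fun k => g (k + 1))]
    -- The mode numbers run from 1 to 2n+1; the null mode 0 makes their number even, ready for the
    -- split by parity.
    have h0 : g 0 = 0 := by simp [hg]
    rw [h0, add_zero]
    refine Finset.sum_congr rfl fun q _ => ?_
    rw [hg, abs_mul]
    have : ((2 * n + 1 : ℕ) : ℝ) + 1 = 2 * (n + 1) := by push_cast; ring
    rw [this]
    push_cast
    rfl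
  rw [hsum, sum_range_two_mul]
  simp only [hg, heven, hodd]
  rw [← mul_add]
  congr 1
  push_cast
  field_simp
  ring

theorem summable_norm_absSinCoeff : Summable fun m => ‖(absSinCoeff m : ℂ)‖ := by
  simpa only [Complex.norm_real] using summable_absSinCoeff.norm

theorem summable_resonant {A : ℤ → ℂ} (hA : Summable fun m => ‖A m‖) {a : ℤ} (b : ℤ)
    (ha : a ≠ 0) : Summable fun r : ℤ => A (r * b) * A (-(r * a)) := by
  have hinj : Function.Injective fun r : ℤ => (r * b, -(r * a)) := by
    intro r s h
    exact mul_right_cancel₀ ha (neg_injective (Prod.mk.inj h).2)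
  have h : Summable fun p : ℤ × ℤ => A p.1 * A p.2 :=
    summable_mul_of_summable_norm (f := A) (g := A) hA hA
  simpa only [Function.comp_def] using h.comp_injective hinj

/-- The product of the Fourier coefficients of `|sin (i x)|` and `|sin (j x)|` at a common
frequency, where `i : j = a : b`. -/
noncomputable def resonantCoeff (a b r : ℤ) : ℝ := absSinCoeff (r * a) * absSinCoeff (r * b)

theorem absSinCoeff_neg (m : ℤ) : absSinCoeff (-m) = absSinCoeff m := by
  simp [absSinCoeff]

theorem summable_resonantCoeff {a : ℤ} (b : ℤ) (ha : a ≠ 0) : Summable (resonantCoeff a b) := by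
  have h := summable_resonant summable_norm_absSinCoeff b ha
  simp only [absSinCoeff_neg] at h
  have h2 : Summable fun r => ((resonantCoeff a b r : ℝ) : ℂ) := by
    refine h.congr fun r => ?_
    rw [resonantCoeff]
    push_cast
    ring
  exact_mod_cast h2

theorem tendsto_sqrt_pmaxCentered {i j : ℕ} (hi : 0 < i) :
    Tendsto (fun n => Real.sqrt (pmaxCentered n i j)) atTop
      (𝓝 (∑' r : ℤ, (1 + (-1) ^ (r * (((i / Nat.gcd i j : ℕ) : ℤ) + (j / Nat.gcd i j : ℕ)))) *
        resonantCoeff (i / Nat.gcd i j : ℕ) (j / Nat.gcd i j : ℕ) r)) := by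
  have ha : ((i / Nat.gcd i j : ℕ) : ℤ) ≠ 0 := by
    have := Nat.div_pos (Nat.gcd_le_left j hi) (Nat.gcd_pos_of_pos_left j hi)
    exact_mod_cast this.ne'
  set a : ℤ := ((i / Nat.gcd i j : ℕ) : ℤ) with had
  set b : ℤ := ((j / Nat.gcd i j : ℕ) : ℤ) with hbd
  have hA' : Summable fun m : ℤ => ‖((-1) ^ m * absSinCoeff m : ℂ)‖ := by
    simpa only [norm_mul, norm_zpow, norm_neg, norm_one, one_zpow, one_mul] using
      summable_norm_absSinCoeff
  have h1 := tendsto_average_mul summable_norm_absSinCoeff hasSum_abs_sin 0 i j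
  have h2 := tendsto_average_mul hA' hasSum_abs_cos (1 / 2) i j
  have e1 := tsum_resonant (fun m => (absSinCoeff m : ℂ)) (j := j) hi
  have e2 := tsum_resonant (fun m => (-1) ^ m * (absSinCoeff m : ℂ)) (j := j) hi
  beta_reduce at e1 e2
  rw [e1, ← had, ← hbd] at h1
  rw [e2, ← had, ← hbd] at h2
  -- Both averages run over M = n + 1 points.
  have h3 := (h1.add h2).comp (tendsto_add_atTop_nat 1)
  rw [← (summable_resonant summable_norm_absSinCoeff b ha).tsum_add
    (summable_resonant hA' b ha)] at h3
  have hlim : ∀ r : ℤ, (absSinCoeff (r * b) : ℂ) * absSinCoeff (-(r * a)) +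
      (-1) ^ (r * b) * absSinCoeff (r * b) * ((-1) ^ (-(r * a)) * absSinCoeff (-(r * a))) =
      (((1 + (-1) ^ (r * (a + b))) * resonantCoeff a b r : ℝ) : ℂ) := by
    intro r
    have hs : (-1 : ℂ) ^ (-(r * a)) = (-1) ^ (r * a) := by
      rw [zpow_neg, ← inv_zpow, inv_neg, inv_one]
    rw [hs, absSinCoeff_neg, resonantCoeff, mul_add r, zpow_add₀ (by norm_num)]
    push_cast
    ring
  simp only [hlim] at h3
  rw [← Complex.ofReal_tsum] at h3
  have h4 := (Complex.continuous_re.tendsto _).comp h3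
  rw [Complex.ofReal_re] at h4
  refine h4.congr' ?_
  -- Beyond this point both sites lie in the chain and the default value 0 is not taken.
  filter_upwards [eventually_ge_atTop i, eventually_ge_atTop j] with n hin hjn
  rw [sqrt_pmaxCentered hin hjn, Function.comp_apply, Function.comp_apply]
  rw [← Complex.ofReal_re (_ + _)]
  congr 1
  push_cast
  rfl

theorem tendsto_sqrt_pmaxCentered_of_even {i j : ℕ} (hi : 0 < i)
    (h : Even (i / Nat.gcd i j + j / Nat.gcd i j)) :
    Tendsto (fun n => Real.sqrt (pmaxCentered n i j)) atTop
      (𝓝 (2 * ∑' r : ℤ, resonantCoeff (i / Nat.gcd i j : ℕ) (j / Nat.gcd i j : ℕ) (1 * r))) := by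
  convert tendsto_sqrt_pmaxCentered (j := j) hi using 2
  rw [← tsum_mul_left]
  refine tsum_congr fun r => ?_
  have he : Even (r * (((i / Nat.gcd i j : ℕ) : ℤ) + (j / Nat.gcd i j : ℕ))) :=
    Even.mul_left (by exact_mod_cast h) _
  rw [he.neg_one_zpow, one_mul]
  norm_num

theorem tendsto_sqrt_pmaxCentered_of_odd {i j : ℕ} (hi : 0 < i)
    (h : Odd (i / Nat.gcd i j + j / Nat.gcd i j)) :
    Tendsto (fun n => Real.sqrt (pmaxCentered n i j)) atTop
      (𝓝 (2 * ∑' r : ℤ, resonantCoeff (i / Nat.gcd i j : ℕ) (j / Nat.gcd i j : ℕ) (2 * r))) := by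
  convert tendsto_sqrt_pmaxCentered (j := j) hi using 2
  have hinj : Function.Injective fun r : ℤ => 2 * r := mul_right_injective₀ two_ne_zero
  have ho : Odd (((i / Nat.gcd i j : ℕ) : ℤ) + (j / Nat.gcd i j : ℕ)) := by exact_mod_cast h
  rw [← hinj.tsum_eq (f := fun r : ℤ => (1 + (-1 : ℝ) ^ (r * (((i / Nat.gcd i j : ℕ) : ℤ) +
    (j / Nat.gcd i j : ℕ)))) * resonantCoeff (i / Nat.gcd i j : ℕ) (j / Nat.gcd i j : ℕ) r),
    ← tsum_mul_left]
  · refine tsum_congr fun r => ?_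
    have he : Even (2 * r * (((i / Nat.gcd i j : ℕ) : ℤ) + (j / Nat.gcd i j : ℕ))) :=
      (even_two_mul r).mul_right _
    rw [he.neg_one_zpow]
    norm_num
  · intro r hr
    rcases Int.even_or_odd r with h2 | h2
    · obtain ⟨s, rfl⟩ := h2
      exact ⟨s, two_mul s⟩
    -- For odd r the weight is 1 - 1 = 0.
    · refine absurd ?_ hr
      simp only [(h2.mul ho).neg_one_zpow]
      norm_num

/-! ### Evaluation of the series by cotangents -/

/-- The term r = 0 is (2/π)² and supplies the summand 2; r and -r contribute equally. The step `e`
is 1 or 2 according to which resonances survive. -/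
theorem exists_hasSum_resonant {a b e : ℕ} (ha : a ≠ 0) (he : e ≠ 0) :
    ∃ S : ℝ, HasSum (fun k : ℕ => 4 / (((2 * e * ((k : ℝ) + 1)) ^ 2 * a ^ 2 - 1) *
        ((2 * e * ((k : ℝ) + 1)) ^ 2 * b ^ 2 - 1))) S ∧
      2 * ∑' r : ℤ, resonantCoeff a b (e * r) = 4 / Real.pi ^ 2 * (2 + S) := by
  have hinj : Function.Injective fun r : ℤ => (e : ℤ) * r :=
    mul_right_injective₀ (by exact_mod_cast he)
  have hs : Summable fun r : ℤ => resonantCoeff a b (e * r) :=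
    (summable_resonantCoeff (b : ℤ) (by exact_mod_cast ha)).comp_injective hinj
  have hpi := Real.pi_ne_zero
  have heq : ∀ k : ℕ, 4 / (((2 * e * ((k : ℝ) + 1)) ^ 2 * a ^ 2 - 1) *
      ((2 * e * ((k : ℝ) + 1)) ^ 2 * b ^ 2 - 1)) =
      Real.pi ^ 2 * resonantCoeff a b (e * ((k + 1 : ℕ) : ℤ)) := by
    intro k
    rw [resonantCoeff, absSinCoeff, absSinCoeff, div_mul_div_comm]
    push_cast
    have hden : Real.pi * (4 * ((e : ℝ) * (k + 1) * a) ^ 2 - 1) *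
        (Real.pi * (4 * ((e : ℝ) * (k + 1) * b) ^ 2 - 1)) = Real.pi ^ 2 *
        (((2 * e * ((k : ℝ) + 1)) ^ 2 * a ^ 2 - 1) *
          ((2 * e * ((k : ℝ) + 1)) ^ 2 * b ^ 2 - 1)) := by
      ring
    rw [hden, ← mul_div_assoc, mul_div_mul_left _ _ (pow_ne_zero 2 hpi)]
    norm_num
  have hev : (fun r : ℤ => resonantCoeff a b (e * r)).Even := by
    intro r
    simp only [resonantCoeff, mul_neg, neg_mul, absSinCoeff_neg]
  have hnat : Summable fun k : ℕ => resonantCoeff a b (e * ((k + 1 : ℕ) : ℤ)) :=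
    hs.comp_injective (i := fun k : ℕ => ((k + 1 : ℕ) : ℤ)) fun k l h => by
      simpa using h
  refine ⟨Real.pi ^ 2 * ∑' k : ℕ, resonantCoeff a b (e * ((k + 1 : ℕ) : ℤ)), ?_, ?_⟩
  · simp only [heq]
    exact hnat.hasSum.mul_left _
  · rw [tsum_int_eq_zero_add_two_mul_tsum_pnat hev hs,
      tsum_pnat_eq_tsum_succ (f := fun k : ℕ => resonantCoeff a b (e * (k : ℤ)))]
    have h0 : resonantCoeff a b (e * 0) = 4 / Real.pi ^ 2 := by
      simp [resonantCoeff, absSinCoeff]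
      field_simp
      norm_num
    rw [h0]
    field_simp
    ring

/-- The partial fraction expansion of the cotangent. -/
theorem hasSum_cot {d : ℝ} (hd : 1 < d) :
    HasSum (fun k : ℕ => 1 / ((d * ((k : ℝ) + 1)) ^ 2 - 1))
      ((1 - Real.pi / d * Real.cot (Real.pi / d)) / 2) := by
  have hd0 : d ≠ 0 := by positivity
  have hmem : ((1 / d : ℝ) : ℂ) ∈ Complex.integerComplement := by
    rw [Complex.mem_integerComplement_iff]
    rintro ⟨n, hn⟩
    have hn' : (n : ℝ) = 1 / d := by exact_mod_cast hn
    have h0 : (0 : ℝ) < n := by rw [hn']; positivity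
    have h1 : (n : ℝ) < 1 := by rw [hn', div_lt_one (by positivity)]; exact hd
    have h0' : 0 < n := by exact_mod_cast h0
    have h1' : n < 1 := by exact_mod_cast h1
    omega
  have h := (summable_cotTerm hmem).hasSum
  rw [show (∑' n, cotTerm ((1 / d : ℝ) : ℂ) n) = _ from (cot_series_rep' hmem).symm] at h
  have hterm : ∀ n : ℕ, cotTerm ((1 / d : ℝ) : ℂ) n =
      ((-2 * d * (1 / ((d * ((n : ℝ) + 1)) ^ 2 - 1)) : ℝ) : ℂ) := by
    intro n
    have hdn : 1 < d * ((n : ℝ) + 1) := by nlinarith [Nat.cast_nonneg (α := ℝ) n]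
    have e1 : (1 / d - ((n : ℝ) + 1)) ≠ 0 := by
      intro h; field_simp at h; linarith
    have e2 : (1 / d + ((n : ℝ) + 1)) ≠ 0 := by positivity
    have e3 : ((d * ((n : ℝ) + 1)) ^ 2 - 1) ≠ 0 := by nlinarith
    have hreal : 1 / (1 / d - ((n : ℝ) + 1)) + 1 / (1 / d + ((n : ℝ) + 1)) =
        -2 * d * (1 / ((d * ((n : ℝ) + 1)) ^ 2 - 1)) := by
      rw [div_add_div _ _ e1 e2, mul_one_div, div_eq_div_iff (mul_ne_zero e1 e2) e3]
      field_simp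
      ring
    rw [← hreal]
    push_cast
    rfl
  have hval : (Real.pi : ℂ) * Complex.cot (Real.pi * ((1 / d : ℝ) : ℂ)) - 1 / ((1 / d : ℝ) : ℂ) =
      ((Real.pi * Real.cot (Real.pi / d) - d : ℝ) : ℂ) := by
    rw [← Complex.ofReal_mul, mul_one_div, ← Complex.ofReal_cot]
    push_cast
    simp
  rw [hval] at h
  simp only [hterm] at h
  -- The factor cancels the -2d that each cotangent term carries.
  have h2 := (Complex.hasSum_ofReal.mp h).mul_left (-1 / (2 * d))
  have hsum : -1 / (2 * d) * (Real.pi * Real.cot (Real.pi / d) - d) =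
      (1 - Real.pi / d * Real.cot (Real.pi / d)) / 2 := by
    generalize Real.cot (Real.pi / d) = y
    field_simp
    ring
  rw [hsum] at h2
  refine h2.congr_fun fun k => ?_
  rw [← mul_assoc, show -1 / (2 * d) * (-2 * d) = 1 by field_simp, one_mul]

/-- Partial fractions in (c(k+1))² reduce the sum to two cotangent expansions, whose constant parts
add up to -2 and cancel the leading 2. -/
theorem eq_cot_of_hasSum {a b c S : ℝ} (ha : 1 < c * a) (hb : 1 < c * b) (hab : a ^ 2 ≠ b ^ 2)
    (hS : HasSum (fun k : ℕ => 4 / (((c * ((k : ℝ) + 1)) ^ 2 * a ^ 2 - 1) *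
      ((c * ((k : ℝ) + 1)) ^ 2 * b ^ 2 - 1))) S) :
    2 + S = 2 * (1 / (a ^ 2 - b ^ 2) * (a ^ 2 * (Real.pi / (c * a)) * Real.cot (Real.pi / (c * a)) -
      b ^ 2 * (Real.pi / (c * b)) * Real.cot (Real.pi / (c * b)))) := by
  have hsub : a ^ 2 - b ^ 2 ≠ 0 := sub_ne_zero.mpr hab
  have h := (((hasSum_cot hb).mul_left (b ^ 2)).sub ((hasSum_cot ha).mul_left (a ^ 2))).mul_left
    (4 / (a ^ 2 - b ^ 2))
  have hne : ∀ (x : ℝ) (k : ℕ), 1 < c * x → (c * ((k : ℝ) + 1)) ^ 2 * x ^ 2 - 1 ≠ 0 := by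
    intro x k hx
    have h1 : 1 < c * x * ((k : ℝ) + 1) := by nlinarith [Nat.cast_nonneg (α := ℝ) k]
    have h2 : (c * ((k : ℝ) + 1)) ^ 2 * x ^ 2 - 1 = (c * x * ((k : ℝ) + 1)) ^ 2 - 1 := by ring
    rw [h2]
    nlinarith
  have hterm : ∀ k : ℕ, 4 / (((c * ((k : ℝ) + 1)) ^ 2 * a ^ 2 - 1) *
      ((c * ((k : ℝ) + 1)) ^ 2 * b ^ 2 - 1)) =
      4 / (a ^ 2 - b ^ 2) * (b ^ 2 * (1 / ((c * b * ((k : ℝ) + 1)) ^ 2 - 1)) -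
        a ^ 2 * (1 / ((c * a * ((k : ℝ) + 1)) ^ 2 - 1))) := by
    intro k
    have h1 := hne a k ha
    have h2 := hne b k hb
    rw [show (c * b * ((k : ℝ) + 1)) ^ 2 - 1 = (c * ((k : ℝ) + 1)) ^ 2 * b ^ 2 - 1 by ring,
      show (c * a * ((k : ℝ) + 1)) ^ 2 - 1 = (c * ((k : ℝ) + 1)) ^ 2 * a ^ 2 - 1 by ring]
    generalize (c * ((k : ℝ) + 1)) ^ 2 = m at *
    field_simp
    ring
  simp only [← hterm] at h
  rw [hS.unique h]
  generalize Real.cot (Real.pi / (c * a)) = y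
  generalize Real.cot (Real.pi / (c * b)) = z
  generalize Real.pi / (c * a) = s
  generalize Real.pi / (c * b) = t
  field_simp
  ring

/-! ### Parity of the reduced pair and conclusion -/

theorem padicValNat_two_eq_zero_iff {x : ℕ} (hx : 0 < x) : padicValNat 2 x = 0 ↔ Odd x := by
  rw [padicValNat.eq_zero_iff, ← Nat.not_even_iff_odd, even_iff_two_dvd]
  simp [hx.ne']

/-- Dividing by the gcd lowers both 2-adic valuations equally, and of two coprime numbers at most
one is even; so the valuations agree exactly when both quotients are odd. -/
theorem even_add_div_gcd_iff {i j : ℕ} (hi : 0 < i) (hj : 0 < j) :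
    Even (i / Nat.gcd i j + j / Nat.gcd i j) ↔ padicValNat 2 i = padicValNat 2 j := by
  obtain ⟨g, a, b, hg, hab, rfl, rfl⟩ := Nat.exists_coprime' (Nat.gcd_pos_of_pos_left j hi)
  have ha : a ≠ 0 := (Nat.pos_of_mul_pos_right hi).ne'
  have hb : b ≠ 0 := (Nat.pos_of_mul_pos_right hj).ne'
  rw [Nat.gcd_mul_right, hab, one_mul, Nat.mul_div_cancel _ hg, Nat.mul_div_cancel _ hg,
    padicValNat.mul ha hg.ne', padicValNat.mul hb hg.ne', Nat.add_right_cancel_iff]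
  have hval : ∀ x : ℕ, x ≠ 0 → (padicValNat 2 x = 0 ↔ ¬ Even x) := fun x hx => by
    rw [padicValNat_two_eq_zero_iff (Nat.pos_of_ne_zero hx), Nat.not_even_iff_odd]
  rw [Nat.even_add]
  by_cases hae : Even a
  · have hbo : ¬ Even b := fun hbe =>
      Nat.not_coprime_of_dvd_of_dvd one_lt_two hae.two_dvd hbe.two_dvd hab
    have h1 := (hval b hb).mpr hbo
    have h2 := (hval a ha).not.mpr (not_not.mpr hae)
    simp only [hae, hbo, h1, h2]
    tauto
  · have h1 := (hval a ha).mpr hae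
    by_cases hbe : Even b
    · have h2 := (hval b hb).not.mpr (not_not.mpr hbe)
      simp only [hae, hbe, h1]
      tauto
    · simp [hae, hbe, h1, (hval b hb).mpr hbe]

end XXChain

theorem theoremt (i j : ℕ) (hi : 0 < i) (hj : 0 < j) (bi bj : ℝ)
    (hbi : bi = ((i / Nat.gcd i j : ℕ) : ℝ)) (hbj : bj = ((j / Nat.gcd i j : ℕ) : ℝ)) :
    (((Odd i ∧ Odd j) ∨ (Even i ∧ Even j ∧ padicValNat 2 i = padicValNat 2 j)) →
      ∃ L : ℝ,
        Filter.Tendsto (fun n : ℕ => Real.sqrt (XXChain.pmaxCentered n i j)) Filter.atTop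
          (nhds L) ∧
        (∃ S : ℝ,
          HasSum (fun k : ℕ =>
            4 / (((2 * ((k : ℝ) + 1)) ^ 2 * bi ^ 2 - 1) *
              ((2 * ((k : ℝ) + 1)) ^ 2 * bj ^ 2 - 1))) S ∧
          L = 4 / Real.pi ^ 2 * (2 + S)) ∧
        (i ≠ j → L = 8 / Real.pi ^ 2 * (1 / (bi ^ 2 - bj ^ 2) *
          (bi ^ 2 * (Real.pi / (2 * bi)) * Real.cot (Real.pi / (2 * bi)) -
            bj ^ 2 * (Real.pi / (2 * bj)) * Real.cot (Real.pi / (2 * bj)))))) ∧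
    (((Even i ∧ Even j ∧ padicValNat 2 i ≠ padicValNat 2 j) ∨
        (Odd i ∧ Even j) ∨ (Even i ∧ Odd j)) →
      ∃ L : ℝ,
        Filter.Tendsto (fun n : ℕ => Real.sqrt (XXChain.pmaxCentered n i j)) Filter.atTop
          (nhds L) ∧
        (∃ S : ℝ,
          HasSum (fun k : ℕ =>
            4 / (((4 * ((k : ℝ) + 1)) ^ 2 * bi ^ 2 - 1) *
              ((4 * ((k : ℝ) + 1)) ^ 2 * bj ^ 2 - 1))) S ∧
          L = 4 / Real.pi ^ 2 * (2 + S)) ∧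
        L = 8 / Real.pi ^ 2 *
          (bi ^ 2 / (bi ^ 2 - bj ^ 2) * (Real.pi / (4 * bi)) * Real.cot (Real.pi / (4 * bi)) -
            bj ^ 2 / (bi ^ 2 - bj ^ 2) * (Real.pi / (4 * bj)) *
              Real.cot (Real.pi / (4 * bj)))) := by
  have hg : 0 < Nat.gcd i j := Nat.gcd_pos_of_pos_left j hi
  have ha0 : 0 < i / Nat.gcd i j := Nat.div_pos (Nat.gcd_le_left j hi) hg
  have hb0 : 0 < j / Nat.gcd i j := Nat.div_pos (Nat.gcd_le_right i hj) hg
  have ha1 : 1 ≤ bi := by rw [hbi]; exact_mod_cast ha0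
  have hb1 : 1 ≤ bj := by rw [hbj]; exact_mod_cast hb0
  have hne : i ≠ j → bi ^ 2 ≠ bj ^ 2 := by
    intro hij h
    have h2 := (sq_eq_sq₀ (by linarith) (by linarith)).mp h
    rw [hbi, hbj] at h2
    have h3 : i / Nat.gcd i j = j / Nat.gcd i j := by exact_mod_cast h2
    apply hij
    rw [← Nat.div_mul_cancel (Nat.gcd_dvd_left i j), h3, Nat.div_mul_cancel (Nat.gcd_dvd_right i j)]
  have hpar := XXChain.even_add_div_gcd_iff hi hj
  constructor
  · intro h
    have hval : padicValNat 2 i = padicValNat 2 j := by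
      rcases h with ⟨h1, h2⟩ | h
      · rw [(XXChain.padicValNat_two_eq_zero_iff hi).mpr h1,
          (XXChain.padicValNat_two_eq_zero_iff hj).mpr h2]
      · exact h.2.2
    obtain ⟨S, hS, hL⟩ := XXChain.exists_hasSum_resonant (b := j / Nat.gcd i j) ha0.ne' one_ne_zero
    rw [Nat.cast_one, mul_one, ← hbi, ← hbj] at hS
    have hlim := XXChain.tendsto_sqrt_pmaxCentered_of_even hi (hpar.mpr hval)
    rw [Nat.cast_one] at hL
    rw [hL] at hlim
    refine ⟨_, hlim, ⟨S, hS, rfl⟩, fun hij => ?_⟩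
    rw [XXChain.eq_cot_of_hasSum (by linarith) (by linarith) (hne hij) hS]
    ring
  · intro h
    have hval : padicValNat 2 i ≠ padicValNat 2 j := by
      have hi' := XXChain.padicValNat_two_eq_zero_iff hi
      have hj' := XXChain.padicValNat_two_eq_zero_iff hj
      rcases h with h | ⟨h1, h2⟩ | ⟨h1, h2⟩
      · exact h.2.2
      · intro heq
        exact Nat.not_odd_iff_even.mpr h2 (hj'.mp (heq ▸ hi'.mpr h1))
      · intro heq
        exact Nat.not_odd_iff_even.mpr h1 (hi'.mp (heq ▸ hj'.mpr h2))
    -- Different valuations already exclude i = j, so the closed form needs no extra hypothesis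
    -- here.
    have hij : i ≠ j := fun h => hval (by rw [h])
    obtain ⟨S, hS, hL⟩ := XXChain.exists_hasSum_resonant (b := j / Nat.gcd i j) ha0.ne' two_ne_zero
    rw [show (2 : ℝ) * ((2 : ℕ) : ℝ) = 4 by norm_num, ← hbi, ← hbj] at hS
    have hlim := XXChain.tendsto_sqrt_pmaxCentered_of_odd hi
      (Nat.not_even_iff_odd.mp (hpar.not.mpr hval))
    rw [Nat.cast_two] at hL
    rw [hL] at hlim
    refine ⟨_, hlim, ⟨S, hS, rfl⟩, ?_⟩
    rw [XXChain.eq_cot_of_hasSum (by linarith) (by linarith) (hne hij) hS]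
    ring
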